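/- Let $d$ be a natural number and $n=d+3$. Let $a_1,\dots,a_n\in\mathbb{R}^d$, and let $A\in\mathbb{R}^{(d+1)\times n}$ be the matrix with columns $(1,a_1),\dots,(1,a_n)$. For $C=(c_{ij})\in\mathbb{R}^{d\times n}$ let $n_{\mathcal A}(C)$ be the (possibly infinite) number of solutions $x\in\mathbb{R}_{>0}^d$ of the system $$\sum_{j=1}^n c_{ij}\,x^{a_j}=0,\qquad i=1,\dots,d.$$ A matrix is uniform if none of its maximal minors vanishes, and a Gale dual of a matrix $M$ of full row rank is a matrix whose columns form a basis of $\ker M$. Assume that $A$ is uniform, and let $B\in\mathbb{R}^{n\times 2}$ be a Gale dual of $A$, with columns $B_1,B_2$ and rows $b_1,\dots,b_n$. Suppose that there are indices $i_1,i_2,i_3,i_4$ such that $b_{i_1},b_{i_2},b_{i_3},b_{i_4}$ lie in the open quadrants of $\mathbb{R}^2$ with signs $(+,+),(-,+),(-,-),(+,-)$, respectively. Let $C\in\mathbb{R}^{d\times n}$ be uniform, with columns $C_1,\dots,C_n$, and suppose that $\mathbf 0\in\mathbb{R}_{>0}C_1+\dots+\mathbb{R}_{>0}C_n$. Let $D\in\mathbb{R}^{n\times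 3}$ be a Gale dual of $C$, with rows $P_1,\dots,P_n$, and let $\mathcal C_P^\nu=\{y\in\mathbb{R}^3:\langle P_i,y\rangle>0,\ i=1,\dots,n\}$. Assume that $P_{i_1},\dots,P_{i_4}$ are normals to facets of the closure of $\mathcal C_P^\nu$, that is, for each $j=1,\dots,4$ the hyperplane $P_{i_j}^\perp$ supports a facet of it. Let $I_C\subset\{1,\dots,n\}$ be the set of indices of the minimal set of generators $\{P_i : i\in I_C\}$ of the polyhedral cone generated by $P_1,\dots,P_n$. Suppose that for $j=1,2$ there is a vector $z\in\ker C$ such that $\operatorname{sign}(z_i)=\operatorname{sign}((B_j)_i)$ for all $i\in I_C$. Then $n_{\mathcal A}(C)>0$. -/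

import Mathlib

open scoped BigOperators Matrix

noncomputable section

namespace GaleSystem

/-- A matrix is uniform if none of its maximal (`r × r`) minors vanishes. -/
def IsUniform {r s : ℕ} (M : Matrix (Fin r) (Fin s) ℝ) : Prop :=
  ∀ f : Fin r ↪ Fin s, (M.submatrix id f).det ≠ 0

/-- `N` is a Gale dual matrix of `M`: the columns of `N` form a basis of the kernel of `M`. -/
def IsGaleDual {r s q : ℕ} (M : Matrix (Fin r) (Fin s) ℝ) (N : Matrix (Fin s) (Fin q) ℝ) : Prop :=
  LinearIndependent ℝ Nᵀ ∧ Submodule.span ℝ (Set.range Nᵀ) = LinearMap.ker M.mulVecLin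

/-- The matrix with columns `(1, a_j)` of a point configuration `a_1, …, a_n` in `ℝ^d`. -/
def configMatrix {d n : ℕ} (a : Fin n → Fin d → ℝ) : Matrix (Fin (d + 1)) (Fin n) ℝ :=
  Matrix.of fun i j => Fin.cons (α := fun _ => ℝ) 1 (a j) i

/-- The positive solutions `x ∈ ℝ_{>0}^d` of the system `∑_j c_{ij} x^{a_j} = 0`, `i = 1, …, d`,
where `x^{a_j} = ∏_l x_l ^ (a_j)_l` has real exponents. -/
def positiveSolutions {d n : ℕ} (a : Fin n → Fin d → ℝ) (C : Matrix (Fin d) (Fin n) ℝ) :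
    Set (Fin d → ℝ) :=
  {x | (∀ l, 0 < x l) ∧ ∀ i, ∑ j, C i j * ∏ l, x l ^ a j l = 0}

/-- The (possibly infinite) number of positive solutions of the system. -/
def numPositiveSolutions {d n : ℕ} (a : Fin n → Fin d → ℝ) (C : Matrix (Fin d) (Fin n) ℝ) : ℕ∞ :=
  (positiveSolutions a C).encard

/-- The cone `ℝ_{>0} v_1 + ⋯ + ℝ_{>0} v_n`. -/
def openCone {n m : ℕ} (v : Fin n → Fin m → ℝ) : Set (Fin m → ℝ) :=
  {u | ∃ c : Fin n → ℝ, (∀ i, 0 < c i) ∧ u = ∑ i, c i • v i}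

/-- The dual open cone `{y | ⟨P_i, y⟩ > 0 for all i}`, where `P_i` is the `i`-th row of `D`. -/
def dualOpenCone {n m : ℕ} (D : Matrix (Fin n) (Fin m) ℝ) : Set (Fin m → ℝ) :=
  {y | ∀ i, 0 < D i ⬝ᵥ y}

/-- `F` is a facet of the convex set `K`: a nonempty exposed face of dimension `dim K - 1`. -/
def IsFacet {m : ℕ} (K F : Set (Fin m → ℝ)) : Prop :=
  IsExposed ℝ K F ∧ F.Nonempty ∧
    Module.finrank ℝ (vectorSpan ℝ F) + 1 = Module.finrank ℝ (vectorSpan ℝ K)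

/-- The vector `p` defines a normal to a facet of the cone `K`: the hyperplane `p^⊥` supports a
facet of `K`. -/
def IsFacetNormal {m : ℕ} (K : Set (Fin m → ℝ)) (p : Fin m → ℝ) : Prop :=
  IsFacet K {y | y ∈ K ∧ p ⬝ᵥ y = 0}

/-- `I` is the index set of a minimal set of generators, among the rows `P_1, …, P_n` of `D`, of
the polyhedral cone generated by `P_1, …, P_n` (`PointedCone.hull` is the set of combinations with
nonnegative coefficients). -/
def IsMinimalGenerating {n m : ℕ} (D : Matrix (Fin n) (Fin m) ℝ) (I : Set (Fin n)) : Prop :=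
  Minimal (fun J : Set (Fin n) =>
    PointedCone.hull ℝ (D '' J) = PointedCone.hull ℝ (Set.range D)) I

/-- The restriction `v_I` of `v ∈ ℝ^n` to the coordinates in `I`. -/
def restrictTo {n : ℕ} (I : Set (Fin n)) (v : Fin n → ℝ) : I → ℝ := fun i => v i

/-- The coordinatewise sign of a real vector. -/
def signVec {ι : Type*} (v : ι → ℝ) : ι → SignType := fun i => SignType.sign (v i)

/-- The four open quadrants of `ℝ²`, in the order `(+,+)`, `(-,+)`, `(-,-)`, `(+,-)`. -/
def openQuadrant : Fin 4 → Set (Fin 2 → ℝ) :=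
  ![{v | 0 < v 0 ∧ 0 < v 1}, {v | v 0 < 0 ∧ 0 < v 1},
    {v | v 0 < 0 ∧ v 1 < 0}, {v | 0 < v 0 ∧ v 1 < 0}]

end GaleSystem

end

open GaleSystem

open Filter Topology Set

/-! By Gale duality (`positiveSolutions_nonempty_of_galeDual`) it suffices to find `u` in the open
cone `U` of all `y` with every `⟨P_i, y⟩ > 0` at which both functions `g_j(u) = ∑ i, B i j * log
⟨P_i, u⟩` vanish. Near a boundary point of `U` other than the apex, `g_j` tends to `-∞` if `B i j >
0` for every vanishing `⟨P_i, ·⟩`, and to `+∞` if all these entries are negative.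

The four facets sit in the four quadrants, so neighbouring ones share the sign of one coordinate
`j`. The vector of `ker C` with the signs of `B_j` yields a boundary path between them along which
that sign persists (`exists_boundary_curve`). Contracted slightly into `U`, the four paths form a
cycle on which `g₂ < 0`, `g₁ > 0`, `g₂ > 0`, `g₁ < 0` in turn. Then `(g₁, g₂)` winds once around the
origin, which is impossible for a nonvanishing map on the convex set `U`
(`exists_common_zero_of_sign_cycle`). -/

/-! ### Winding of planar maps. -/

/-- On a connected set the distance from `θ` to a fixed `α + 2πk` cannot cross `π / 2`, where the
cosine vanishes; so one branch of the argument serves the whole set. -/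
theorem exists_int_abs_sub_lt_of_cos_pos {X : Type*} [TopologicalSpace X] {S : Set X}
    (hS : IsPreconnected S) {θ : X → ℝ} (hθ : ContinuousOn θ S) (α : ℝ)
    (h : ∀ x ∈ S, 0 < Real.cos (θ x - α)) :
    ∃ k : ℤ, ∀ x ∈ S, |θ x - α - k * (2 * Real.pi)| < Real.pi / 2 := by
  rcases S.eq_empty_or_nonempty with rfl | ⟨x₀, hx₀⟩
  · exact ⟨0, by simp⟩
  have hpi := Real.pi_pos
  set k : ℤ := round ((θ x₀ - α) / (2 * Real.pi)) with hk
  have hcos : ∀ x, Real.cos |θ x - α - k * (2 * Real.pi)| = Real.cos (θ x - α) := fun x => by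
    rw [Real.cos_abs, Real.cos_sub_int_mul_two_pi]
  have h0 : |θ x₀ - α - k * (2 * Real.pi)| < Real.pi / 2 := by
    have h1 := abs_sub_round ((θ x₀ - α) / (2 * Real.pi))
    have h2 : θ x₀ - α - k * (2 * Real.pi)
        = ((θ x₀ - α) / (2 * Real.pi) - k) * (2 * Real.pi) := by field_simp
    have h3 : |θ x₀ - α - k * (2 * Real.pi)| ≤ Real.pi := by
      rw [h2, abs_mul, abs_of_pos (by positivity : (0:ℝ) < 2 * Real.pi)]
      nlinarith
    by_contra hcon
    have h4 := Real.cos_nonpos_of_pi_div_two_le_of_le (not_lt.1 hcon) (by linarith)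
    rw [hcos] at h4
    exact absurd (h x₀ hx₀) (not_lt.2 h4)
  refine ⟨k, fun x hx => ?_⟩
  by_contra hcon
  obtain ⟨z, hz, hz'⟩ := hS.intermediate_value hx₀ hx
    (f := fun x => |θ x - α - k * (2 * Real.pi)|) (by fun_prop) ⟨h0.le, not_lt.1 hcon⟩
  have h5 := hcos z
  simp only at hz'
  rw [hz', Real.cos_pi_div_two] at h5
  exact (h z hz).ne h5

/-- A planar map on a convex open set has a zero if it turns around the origin along
four overlapping connected sets. -/
theorem exists_common_zero_of_sign_cycle {E : Type*} [NormedAddCommGroup E] [NormedSpace ℝ E]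
    {U : Set E} (hUc : Convex ℝ U) (hUo : IsOpen U) {g₁ g₂ : E → ℝ}
    (hg₁ : ContinuousOn g₁ U) (hg₂ : ContinuousOn g₂ U) {S : Fin 4 → Set E}
    (hSU : ∀ j, S j ⊆ U) (hS : ∀ j, IsPreconnected (S j))
    (hS' : ∀ j, (S j ∩ S (j + 1)).Nonempty)
    (h₀ : ∀ x ∈ S 0, g₂ x < 0) (h₁ : ∀ x ∈ S 1, 0 < g₁ x)
    (h₂ : ∀ x ∈ S 2, 0 < g₂ x) (h₃ : ∀ x ∈ S 3, g₁ x < 0) :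
    ∃ u ∈ U, g₁ u = 0 ∧ g₂ u = 0 := by
  by_contra! hcon
  have hne : U.Nonempty := (hS' 0).mono fun x hx => hSU 0 hx.1
  have hsc : IsSimplyConnected U := by
    have := hUc.contractibleSpace hne
    exact (inferInstance : SimplyConnectedSpace U)
  -- A continuous logarithm of `g₁ + i g₂`; its imaginary part is a global argument on `U`.
  obtain ⟨f, hf, hfg⟩ := Complex.exists_continuousOn_eqOn_exp_comp hsc hUo
    (g := fun x => (⟨g₁ x, g₂ x⟩ : ℂ))
    (by
      have : (fun x => (⟨g₁ x, g₂ x⟩ : ℂ)) = fun x => (g₁ x : ℂ) + g₂ x * Complex.I := by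
        ext x; exact Complex.mk_eq_add_mul_I _ _
      rw [this]
      exact (Complex.continuous_ofReal.comp_continuousOn hg₁).add
        ((Complex.continuous_ofReal.comp_continuousOn hg₂).mul continuousOn_const))
    (by
      rintro ⟨x, hx, hx'⟩
      exact hcon x hx (congrArg Complex.re hx') (congrArg Complex.im hx'))
  have hre : ∀ x ∈ U, g₁ x = Real.exp (f x).re * Real.cos (f x).im := fun x hx => by
    rw [← Complex.exp_re]; exact (congrArg Complex.re (hfg hx)).symm
  have him : ∀ x ∈ U, g₂ x = Real.exp (f x).re * Real.sin (f x).im := fun x hx => by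
    rw [← Complex.exp_im]; exact (congrArg Complex.im (hfg hx)).symm
  have hθ : ContinuousOn (fun x => (f x).im) U := Complex.continuous_im.comp_continuousOn hf
  have hpi := Real.pi_pos
  obtain ⟨k₀, hk₀⟩ := exists_int_abs_sub_lt_of_cos_pos (hS 0) (hθ.mono (hSU 0)) (-(Real.pi / 2))
    fun x hx => by
      have := h₀ x hx
      rw [him x (hSU 0 hx)] at this
      rw [sub_neg_eq_add, Real.cos_add_pi_div_two]
      linarith [(pos_iff_neg_of_mul_neg this).1 (Real.exp_pos _)]
  obtain ⟨k₁, hk₁⟩ := exists_int_abs_sub_lt_of_cos_pos (hS 1) (hθ.mono (hSU 1)) 0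
    fun x hx => by
      have := h₁ x hx
      rw [hre x (hSU 1 hx)] at this
      rw [sub_zero]
      exact pos_of_mul_pos_right this (Real.exp_pos _).le
  obtain ⟨k₂, hk₂⟩ := exists_int_abs_sub_lt_of_cos_pos (hS 2) (hθ.mono (hSU 2)) (Real.pi / 2)
    fun x hx => by
      have := h₂ x hx
      rw [him x (hSU 2 hx)] at this
      rw [Real.cos_sub_pi_div_two]
      exact pos_of_mul_pos_right this (Real.exp_pos _).le
  obtain ⟨k₃, hk₃⟩ := exists_int_abs_sub_lt_of_cos_pos (hS 3) (hθ.mono (hSU 3)) Real.pi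
    fun x hx => by
      have := h₃ x hx
      rw [hre x (hSU 3 hx)] at this
      rw [Real.cos_sub_pi]
      linarith [(pos_iff_neg_of_mul_neg this).1 (Real.exp_pos _)]
  have key : ∀ (k l : ℤ) (c : ℝ), |c + (k - l) * (2 * Real.pi)| < Real.pi → |c| < Real.pi →
      k = l := by
    intro k l c h h'
    have h2 : |((k - l : ℤ) : ℝ)| < 1 := by
      have : |((k - l : ℤ) : ℝ) * (2 * Real.pi)| < 2 * Real.pi := by
        push_cast
        rw [abs_lt] at *
        constructor <;> linarith
      rw [abs_mul, abs_of_pos (by positivity : (0:ℝ) < 2 * Real.pi)] at this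
      nlinarith
    have h3 : |k - l| < 1 := by exact_mod_cast h2
    have := Int.abs_lt_one_iff.1 h3
    omega
  obtain ⟨x, hx, hx'⟩ := hS' 0
  obtain ⟨y, hy, hy'⟩ := hS' 1
  obtain ⟨z, hz, hz'⟩ := hS' 2
  obtain ⟨w, hw, hw'⟩ := hS' 3
  have e₀ : k₀ = k₁ := by
    have a := abs_lt.1 (hk₀ x hx)
    have b := abs_lt.1 (hk₁ x hx')
    refine key _ _ (-(Real.pi / 2)) ?_ ?_ <;> rw [abs_lt] <;> constructor <;> linarith
  have e₁ : k₁ = k₂ := by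
    have a := abs_lt.1 (hk₁ y hy)
    have b := abs_lt.1 (hk₂ y hy')
    refine key _ _ (-(Real.pi / 2)) ?_ ?_ <;> rw [abs_lt] <;> constructor <;> linarith
  have e₂ : k₂ = k₃ := by
    have a := abs_lt.1 (hk₂ z hz)
    have b := abs_lt.1 (hk₃ z hz')
    refine key _ _ (-(Real.pi / 2)) ?_ ?_ <;> rw [abs_lt] <;> constructor <;> linarith
  have a := abs_lt.1 (hk₃ w hw)
  have b := abs_lt.1 (hk₀ w hw')
  -- The arcs are centred at `-π/2`, `0`, `π/2`, `π`; closing the cycle passes from `π` to `3π/2 =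
  -- -π/2 + 2π`, hence the shift by one.
  have e₃ : k₃ + 1 = k₀ := by
    refine key _ _ (-(Real.pi / 2)) ?_ ?_ <;> rw [abs_lt] <;> push_cast <;>
      constructor <;> linarith
  omega

/-! ### Logarithmic sums near the boundary of a polyhedral cone. -/

/-- A property that holds near a compact subset of the closure of an open convex set holds on
all slight contractions of that subset. -/
theorem eventually_forall_contraction {E : Type*} [NormedAddCommGroup E] [NormedSpace ℝ E]
    {U K S : Set E} {u₀ : E} (hU : ∀ ε : ℝ, 0 < ε → ε < 1 → ∀ x ∈ K, (1 - ε) • x + ε • u₀ ∈ U)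
    (hSK : S ⊆ K) (hS : IsCompact S) {p : E → Prop} (hp : ∀ x ∈ S, ∀ᶠ u in 𝓝[U] x, p u) :
    ∀ᶠ ε : ℝ in 𝓝[>] 0, ∀ x ∈ S, p ((1 - ε) • x + ε • u₀) := by
  have h := hS.eventually_forall_of_forall_eventually (x₀ := (0 : ℝ))
    (P := fun ε y => 0 < ε → ε < 1 → y ∈ S → p ((1 - ε) • y + ε • u₀)) fun y hy => by
      have h1 : Tendsto (fun z : ℝ × E => (1 - z.1) • z.2 + z.1 • u₀) (𝓝 ((0 : ℝ), y)) (𝓝 y) := by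
        have : Continuous (fun z : ℝ × E => (1 - z.1) • z.2 + z.1 • u₀) := by fun_prop
        simpa using this.tendsto ((0 : ℝ), y)
      filter_upwards [h1.eventually (eventually_nhdsWithin_iff.1 (hp y hy))] with z hz h0 h1 hzS
      exact hz (hU _ h0 h1 _ (hSK hzS))
  have h1 : ∀ᶠ ε : ℝ in 𝓝[>] 0, ε < 1 :=
    eventually_nhdsWithin_of_eventually_nhds (eventually_lt_nhds one_pos)
  filter_upwards [eventually_nhdsWithin_of_eventually_nhds h, h1, self_mem_nhdsWithin]
    with ε h h1 h0 x hx
  exact h x hx h0 h1 hx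

/-- A combination of logarithms of continuous functions tends to `-∞` at a point at which some of
them vanish, all those with positive coefficients. -/
theorem tendsto_sum_mul_log_atBot {X ι : Type*} [TopologicalSpace X] [Fintype ι] {l : ι → X → ℝ}
    (hl : ∀ i, Continuous (l i)) (β : ι → ℝ) {x : X} {i₀ : ι} (h₀ : l i₀ x = 0)
    (hβ : ∀ i, l i x = 0 → 0 < β i) :
    Tendsto (fun u => ∑ i, β i * Real.log (l i u)) (𝓝[{u | ∀ i, 0 < l i u}] x) atBot := by
  classical
  set F := 𝓝[{u | ∀ i, 0 < l i u}] x
  have hlt : ∀ i, Tendsto (l i) F (𝓝 (l i x)) := fun i => ((hl i).tendsto x).mono_left inf_le_left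
  have hbot : ∀ i, l i x = 0 → Tendsto (fun u => β i * Real.log (l i u)) F atBot := by
    intro i hi
    refine Tendsto.const_mul_atBot (hβ i hi) (Real.tendsto_log_nhdsGT_zero.comp ?_)
    refine tendsto_nhdsWithin_iff.2 ⟨hi ▸ hlt i, ?_⟩
    filter_upwards [self_mem_nhdsWithin] with u hu using hu i
  have hbd : ∀ i, ∃ c : ℝ, ∀ᶠ u in F, β i * Real.log (l i u) ≤ c := by
    intro i
    by_cases hi : l i x = 0
    · exact ⟨0, (hbot i hi).eventually_le_atBot 0⟩
    · have := ((Real.continuousAt_log hi).tendsto.comp (hlt i)).const_mul (β i)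
      exact ⟨_, this.eventually_le_const (lt_add_one _)⟩
  choose c hc using hbd
  have hsum : ∀ᶠ u in F, ∑ i ∈ Finset.univ.erase i₀, β i * Real.log (l i u)
      ≤ ∑ i ∈ Finset.univ.erase i₀, c i := by
    filter_upwards [eventually_all.2 hc] with u hu using Finset.sum_le_sum fun i _ => hu i
  have := tendsto_atBot_add_right_of_ge' F _ (hbot i₀ h₀) hsum
  refine this.congr fun u => ?_
  rw [Finset.add_sum_erase _ (fun i => β i * Real.log (l i u)) (Finset.mem_univ i₀)]

/-- Two facet points of a polyhedral cone are joined inside the part of the boundary which is seen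
from the direction `-v`, provided that both facets are. -/
theorem exists_boundary_curve {E ι : Type*} [NormedAddCommGroup E] [NormedSpace ℝ E] [Fintype ι]
    {l : ι → E →L[ℝ] ℝ} {I : Set ι}
    (hI : ∀ x, (∀ i ∈ I, 0 ≤ l i x) → x ≠ 0 → ∀ i ∉ I, 0 < l i x)
    {v m m' : E} {q q' r : ι} (hqq : q ≠ q') (hqI : q ∈ I) (hqI' : q' ∈ I)
    (hm : l q m = 0) (hm_pos : ∀ i ≠ q, 0 < l i m)
    (hm' : l q' m' = 0) (hm_pos' : ∀ i ≠ q', 0 < l i m')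
    (hqv : 0 < l q v) (hqv' : 0 < l q' v) (hrv : l r v < 0) :
    ∃ S : Set E, IsCompact S ∧ IsPreconnected S ∧ m ∈ S ∧ m' ∈ S ∧
      ∀ x ∈ S, (∀ i, 0 ≤ l i x) ∧ (∃ i, l i x = 0) ∧ ∀ i, l i x = 0 → i ∈ I ∧ 0 < l i v := by
  classical
  set J : Finset ι := Finset.univ.filter fun i => i ∈ I ∧ 0 < l i v
  have hJ : ∀ {i}, i ∈ J ↔ i ∈ I ∧ 0 < l i v := by simp [J]
  have hqJ : q ∈ J := hJ.2 ⟨hqI, hqv⟩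
  have hqJ' : q' ∈ J := hJ.2 ⟨hqI', hqv'⟩
  have hne : J.Nonempty := ⟨q, hqJ⟩
  set X : ℝ → E := fun t => (1 - t) • m + t • m' with hX
  -- The largest multiple of `v` that can be subtracted from `X t` before some constraint in `J`
  -- fails.
  set τ : ℝ → ℝ := fun t => J.inf' hne fun i => l i (X t) / l i v with hτ
  set γ : ℝ → E := fun t => X t - τ t • v with hγ
  have hXc : Continuous X := by fun_prop
  have hτc : Continuous τ := by
    refine Continuous.finset_inf'_apply hne fun i _ => ?_
    exact ((l i).continuous.comp hXc).div_const _
  have hγc : Continuous γ := hXc.sub (hτc.smul continuous_const)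
  have hlX : ∀ i t, l i (X t) = (1 - t) * l i m + t * l i m' := fun i t => by simp [hX]
  have hlγ : ∀ i t, l i (γ t) = l i (X t) - τ t * l i v := fun i t => by simp [hγ]
  have hm0 : ∀ i, 0 ≤ l i m := fun i => by
    by_cases h : i = q
    · rw [h, hm]
    · exact (hm_pos i h).le
  have hm0' : ∀ i, 0 ≤ l i m' := fun i => by
    by_cases h : i = q'
    · rw [h, hm']
    · exact (hm_pos' i h).le
  have hX0 : ∀ i, ∀ t ∈ Icc (0 : ℝ) 1, 0 ≤ l i (X t) := fun i t ht => by
    rw [hlX]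
    exact add_nonneg (mul_nonneg (by linarith [ht.2]) (hm0 i)) (mul_nonneg ht.1 (hm0' i))
  have hXpos : ∀ i, i ≠ q → i ≠ q' → ∀ t ∈ Icc (0 : ℝ) 1, 0 < l i (X t) := fun i h h' t ht => by
    rw [hlX]
    rcases eq_or_lt_of_le ht.1 with h0 | h0
    · subst h0; simpa using hm_pos i h
    · exact add_pos_of_nonneg_of_pos (mul_nonneg (by linarith [ht.2]) (hm0 i))
        (mul_pos h0 (hm_pos' i h'))
  have hτ0 : ∀ t ∈ Icc (0 : ℝ) 1, 0 ≤ τ t := fun t ht =>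
    (Finset.le_inf'_iff _ _).2 fun i hi => div_nonneg (hX0 i t ht) (hJ.1 hi).2.le
  have hτle : ∀ t, ∀ i ∈ J, τ t * l i v ≤ l i (X t) := fun t i hi =>
    (le_div_iff₀ (hJ.1 hi).2).1 (Finset.inf'_le _ hi)
  have hvneg : ∀ i, l i v ≤ 0 → ∀ t ∈ Icc (0 : ℝ) 1, 0 < l i (γ t) := fun i hi t ht => by
    have h1 : i ≠ q := by rintro rfl; linarith
    have h2 : i ≠ q' := by rintro rfl; linarith
    rw [hlγ]
    nlinarith [hXpos i h1 h2 t ht, hτ0 t ht]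
  have hγI : ∀ i ∈ I, ∀ t ∈ Icc (0 : ℝ) 1, 0 ≤ l i (γ t) := fun i hi t ht => by
    rcases le_or_gt (l i v) 0 with h | h
    · exact (hvneg i h t ht).le
    · rw [hlγ]; linarith [hτle t i (hJ.2 ⟨hi, h⟩)]
  -- The index `r` keeps the path away from the apex, where all constraints vanish.
  have hγ0 : ∀ t ∈ Icc (0 : ℝ) 1, γ t ≠ 0 := fun t ht h => by
    have := hvneg r hrv.le t ht
    simp [h] at this
  have hγnI : ∀ i ∉ I, ∀ t ∈ Icc (0 : ℝ) 1, 0 < l i (γ t) := fun i hi t ht =>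
    hI _ (fun k hk => hγI k hk t ht) (hγ0 t ht) i hi
  refine ⟨γ '' Icc 0 1, isCompact_Icc.image hγc, isPreconnected_Icc.image _ hγc.continuousOn,
    ⟨0, by simp, ?_⟩, ⟨1, by simp, ?_⟩, ?_⟩
  · have h0 : τ 0 = 0 := by
      have := hτle 0 q hqJ
      rw [hlX, hm] at this
      refine le_antisymm ?_ (hτ0 0 (by simp))
      by_contra h
      nlinarith [mul_pos (not_le.1 h) hqv]
    simp [hγ, h0, hX]
  · have h0 : τ 1 = 0 := by
      have := hτle 1 q' hqJ'
      rw [hlX, hm'] at this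
      refine le_antisymm ?_ (hτ0 1 (by simp))
      by_contra h
      nlinarith [mul_pos (not_le.1 h) hqv']
    simp [hγ, h0, hX]
  · rintro _ ⟨t, ht, rfl⟩
    refine ⟨fun i => ?_, ?_, fun i hi => ?_⟩
    · by_cases h : i ∈ I
      · exact hγI i h t ht
      · exact (hγnI i h t ht).le
    · obtain ⟨i, hi, hi'⟩ := J.exists_mem_eq_inf' hne fun i => l i (X t) / l i v
      refine ⟨i, ?_⟩
      have h : τ t = l i (X t) / l i v := hi'
      rw [hlγ, h, div_mul_cancel₀ _ (hJ.1 hi).2.ne', sub_self]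
    · refine ⟨?_, ?_⟩ <;> by_contra h
      · exact (hγnI i h t ht).ne' hi
      · exact (hvneg i (not_lt.1 h) t ht).ne' hi

/-- Each of the four boundary paths makes one of the two sums keep a strict sign nearby; pushing the
paths towards `u₀` gives the sign cycle. -/
theorem exists_zero_logarithmic_map {E ι : Type*} [NormedAddCommGroup E] [NormedSpace ℝ E]
    [Fintype ι] {l : ι → E →L[ℝ] ℝ} {I : Set ι}
    (hI : ∀ x, (∀ i ∈ I, 0 ≤ l i x) → x ≠ 0 → ∀ i ∉ I, 0 < l i x)
    {u₀ : E} (hu₀ : ∀ i, 0 < l i u₀)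
    {β : Fin 2 → ι → ℝ} {v : Fin 2 → E}
    (hβ : ∀ j, ∀ i ∈ I, SignType.sign (l i (v j)) = SignType.sign (β j i))
    {q : Fin 4 → ι} (hqI : ∀ k, q k ∈ I) (hq : ∀ k, (fun j => β j (q k)) ∈ openQuadrant k)
    {m : Fin 4 → E} (hm : ∀ k, l (q k) (m k) = 0) (hm_pos : ∀ k, ∀ i ≠ q k, 0 < l i (m k)) :
    ∃ u, (∀ i, 0 < l i u) ∧ ∀ j, ∑ i, β j i * Real.log (l i u) = 0 := by
  set U : Set E := {u | ∀ i, 0 < l i u} with hU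
  have hUo : IsOpen U := by
    simp only [hU, ofPred_forall]
    exact isOpen_iInter_of_finite fun i => isOpen_lt continuous_const (l i).continuous
  have hUc : Convex ℝ U := by
    simp only [hU, ofPred_forall]
    exact convex_iInter fun i => convex_halfSpace_gt (l i).isLinear 0
  have hcont : ∀ j, ContinuousOn (fun u => ∑ i, β j i * Real.log (l i u)) U := fun j =>
    continuousOn_finsetSum _ fun i _ => continuousOn_const.mul
      ((l i).continuous.continuousOn.log fun u hu => (hu i).ne')
  have hposβ : ∀ j, ∀ i ∈ I, 0 < l i (v j) ↔ 0 < β j i := fun j i hi => by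
    rw [← sign_eq_one_iff, hβ j i hi, sign_eq_one_iff]
  have hnegβ : ∀ j, ∀ i ∈ I, l i (v j) < 0 ↔ β j i < 0 := fun j i hi => by
    rw [← sign_eq_neg_one_iff, hβ j i hi, sign_eq_neg_one_iff]
  have h0 := hq 0
  have h1 := hq 1
  have h2 := hq 2
  have h3 := hq 3
  simp only [openQuadrant, Matrix.cons_val, mem_ofPred_eq] at h0 h1 h2 h3
  -- Here `j` is the coordinate whose sign `σ` the two facets share, and `r` a facet of the opposite
  -- sign.
  have hcurve : ∀ (k k' : Fin 4) (σ : ℝ) (j : Fin 2) (r : Fin 4), q k ≠ q k' →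
      (σ = 1 ∨ σ = -1) → 0 < σ * β j (q k) → 0 < σ * β j (q k') → σ * β j (q r) < 0 →
      ∃ S : Set E, IsCompact S ∧ IsPreconnected S ∧ m k ∈ S ∧ m k' ∈ S ∧
        S ⊆ {x | ∀ i, 0 ≤ l i x} ∧
        ∀ x ∈ S, ∀ᶠ u in 𝓝[U] x, σ * ∑ i, β j i * Real.log (l i u) < 0 := by
    intro k k' σ j r hkk hσ hk hk' hr
    have hpos : ∀ i ∈ I, 0 < l i (σ • v j) ↔ 0 < σ * β j i := fun i hi => by
      rcases hσ with rfl | rfl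
      · simpa using hposβ j i hi
      · simpa using hnegβ j i hi
    have hneg : ∀ i ∈ I, l i (σ • v j) < 0 ↔ σ * β j i < 0 := fun i hi => by
      rcases hσ with rfl | rfl
      · simpa using hnegβ j i hi
      · simpa using hposβ j i hi
    obtain ⟨S, hS, hSp, hSm, hSm', h⟩ := exists_boundary_curve hI hkk (hqI k) (hqI k')
      (hm k) (hm_pos k) (hm k') (hm_pos k') ((hpos _ (hqI k)).2 hk) ((hpos _ (hqI k')).2 hk')
      ((hneg _ (hqI r)).2 hr)
    refine ⟨S, hS, hSp, hSm, hSm', fun x hx => (h x hx).1, fun x hx => ?_⟩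
    obtain ⟨-, ⟨i₀, hi₀⟩, hz⟩ := h x hx
    have ht := tendsto_sum_mul_log_atBot (l := fun i => l i) (fun i => (l i).continuous)
      (fun i => σ * β j i) hi₀ fun i hi => (hpos i (hz i hi).1).1 (hz i hi).2
    filter_upwards [ht.eventually_lt_atBot 0] with u hu
    rw [Finset.mul_sum]
    simpa only [mul_assoc] using hu
  have hcontr : ∀ ε : ℝ, 0 < ε → ε < 1 → ∀ x ∈ {x | ∀ i, 0 ≤ l i x},
      (1 - ε) • x + ε • u₀ ∈ U := fun ε hε hε' x hx i => by
    have := mul_pos hε (hu₀ i)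
    have := mul_nonneg (sub_nonneg.2 hε'.le) (hx i)
    simp only [map_add, map_smul, smul_eq_mul]
    linarith
  have hne : ∀ (k k' : Fin 4) (j : Fin 2), β j (q k) * β j (q k') < 0 → q k ≠ q k' :=
    fun k k' j h h' => by rw [h'] at h; nlinarith [mul_self_nonneg (β j (q k'))]
  obtain ⟨S₀, c₀, p₀, a₀, b₀, s₀, e₀⟩ := hcurve 0 1 1 1 2
    (hne 0 1 0 (mul_neg_of_pos_of_neg h0.1 h1.1)) (by simp) (by linarith) (by linarith)
    (by linarith)
  obtain ⟨S₁, c₁, p₁, a₁, b₁, s₁, e₁⟩ := hcurve 1 2 (-1) 0 0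
    (hne 1 2 1 (mul_neg_of_pos_of_neg h1.2 h2.2)) (by simp) (by linarith) (by linarith)
    (by linarith)
  obtain ⟨S₂, c₂, p₂, a₂, b₂, s₂, e₂⟩ := hcurve 2 3 (-1) 1 0
    (hne 2 3 0 (mul_neg_of_neg_of_pos h2.1 h3.1)) (by simp) (by linarith) (by linarith)
    (by linarith)
  obtain ⟨S₃, c₃, p₃, a₃, b₃, s₃, e₃⟩ := hcurve 3 0 1 0 1
    (hne 3 0 1 (mul_neg_of_neg_of_pos h3.2 h0.2)) (by simp) (by linarith) (by linarith)
    (by linarith)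
  have hlt : ∀ᶠ ε : ℝ in 𝓝[>] 0, ε < 1 :=
    eventually_nhdsWithin_of_eventually_nhds (eventually_lt_nhds one_pos)
  obtain ⟨ε, hε0, hε1, f₀, f₁, f₂, f₃⟩ := (eventually_mem_nhdsWithin.and (hlt.and
    ((eventually_forall_contraction hcontr s₀ c₀ e₀).and
    ((eventually_forall_contraction hcontr s₁ c₁ e₁).and
    ((eventually_forall_contraction hcontr s₂ c₂ e₂).and
    (eventually_forall_contraction hcontr s₃ c₃ e₃)))))).exists
  have hcc : Continuous fun x : E => (1 - ε) • x + ε • u₀ := by fun_prop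
  obtain ⟨u, hu, hu0, hu1⟩ := exists_common_zero_of_sign_cycle hUc hUo (hcont 0) (hcont 1)
    (S := fun k => (fun x : E => (1 - ε) • x + ε • u₀) '' ![S₀, S₁, S₂, S₃] k)
    (by
      have hsub : ∀ k, ![S₀, S₁, S₂, S₃] k ⊆ {x | ∀ i, 0 ≤ l i x} := by
        intro k; fin_cases k <;> assumption
      rintro k _ ⟨x, hx, rfl⟩
      exact hcontr ε hε0 hε1 x (hsub k hx))
    (by
      have hp : ∀ k, IsPreconnected (![S₀, S₁, S₂, S₃] k) := by
        intro k; fin_cases k <;> assumption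
      exact fun k => (hp k).image _ hcc.continuousOn)
    (by
      intro k
      refine Nonempty.mono (image_inter_subset _ _ _) (Nonempty.image _ ⟨m (k + 1), ?_⟩)
      fin_cases k
      · exact ⟨b₀, a₁⟩
      · exact ⟨b₁, a₂⟩
      · exact ⟨b₂, a₃⟩
      · exact ⟨b₃, a₀⟩)
    (by rintro _ ⟨x, hx, rfl⟩; linarith [f₀ x hx])
    (by rintro _ ⟨x, hx, rfl⟩; linarith [f₁ x hx])
    (by rintro _ ⟨x, hx, rfl⟩; linarith [f₂ x hx])
    (by rintro _ ⟨x, hx, rfl⟩; linarith [f₃ x hx])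
  refine ⟨u, hu, fun j => ?_⟩
  fin_cases j
  · exact hu0
  · exact hu1

/-! ### Gale duals of uniform matrices and the facets of the dual cone. -/

theorem GaleSystem.IsGaleDual.mulVec_eq_zero_iff {r s k : ℕ} {M : Matrix (Fin r) (Fin s) ℝ}
    {N : Matrix (Fin s) (Fin k) ℝ} (h : IsGaleDual M N) {z : Fin s → ℝ} :
    M *ᵥ z = 0 ↔ ∃ y, N *ᵥ y = z := by
  have h1 : LinearMap.range N.mulVecLin = LinearMap.ker M.mulVecLin := by
    rw [← h.2, Matrix.range_mulVecLin]; rfl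
  have h2 := SetLike.ext_iff.1 h1 z
  simpa using h2.symm

theorem GaleSystem.IsGaleDual.mulVec_injective {r s k : ℕ} {M : Matrix (Fin r) (Fin s) ℝ}
    {N : Matrix (Fin s) (Fin k) ℝ} (h : IsGaleDual M N) : Function.Injective N.mulVec :=
  Matrix.mulVec_injective_iff.2 h.1

/-- Off `T` only `r` columns remain, and their minor is nonzero. -/
theorem GaleSystem.IsUniform.eq_zero_of_mulVec_eq_zero {r s : ℕ} {M : Matrix (Fin r) (Fin s) ℝ}
    (hM : IsUniform M) {z : Fin s → ℝ} (hz : M *ᵥ z = 0) {T : Finset (Fin s)}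
    (hT : Tᶜ.card = r) (hzT : ∀ i ∈ T, z i = 0) : z = 0 := by
  set g : Fin r ↪ Fin s := (Tᶜ.orderEmbOfFin hT).toEmbedding with hg
  have hgT : Finset.univ.map g = Tᶜ := by
    simp [hg]
  have h1 : M.submatrix id g *ᵥ (z ∘ g) = 0 := by
    ext i
    have h2 := congrFun hz i
    simp only [Matrix.mulVec, dotProduct, Pi.zero_apply] at h2
    rw [← Finset.sum_subset (Finset.subset_univ (Finset.univ.map g)), Finset.sum_map] at h2
    · simpa [Matrix.mulVec, dotProduct] using h2
    · intro j _ hj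
      rw [hgT, Finset.mem_compl, not_not] at hj
      rw [hzT j hj, mul_zero]
  have h2 := Matrix.eq_zero_of_mulVec_eq_zero (hM g) h1
  ext i
  by_cases hi : i ∈ T
  · exact hzT i hi
  · rw [← Finset.mem_compl, ← hgT] at hi
    obtain ⟨k, -, rfl⟩ := Finset.mem_map.1 hi
    exact congrFun h2 k

/-- Any three rows of a Gale dual of a uniform matrix of corank three are independent. -/
theorem eq_zero_of_three_rows {d : ℕ} {C : Matrix (Fin d) (Fin (d + 3)) ℝ} (hC : IsUniform C)
    {D : Matrix (Fin (d + 3)) (Fin 3) ℝ} (hD : IsGaleDual C D) {i j k : Fin (d + 3)}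
    (hij : i ≠ j) (hik : i ≠ k) (hjk : j ≠ k) {y : Fin 3 → ℝ} (hi : D i ⬝ᵥ y = 0)
    (hj : D j ⬝ᵥ y = 0) (hk : D k ⬝ᵥ y = 0) : y = 0 := by
  refine hD.mulVec_injective ?_
  rw [Matrix.mulVec_zero]
  refine hC.eq_zero_of_mulVec_eq_zero (hD.mulVec_eq_zero_iff.2 ⟨y, rfl⟩) (T := {i, j, k}) ?_ ?_
  · rw [Finset.card_compl, Finset.card_eq_three.2 ⟨i, j, k, hij, hik, hjk, rfl⟩]
    simp
  · simp only [Finset.mem_insert, Finset.mem_singleton]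
    rintro _ (rfl | rfl | rfl) <;> assumption

theorem exists_ne_ne {d : ℕ} (i j : Fin (d + 3)) : ∃ k, i ≠ k ∧ j ≠ k := by
  obtain ⟨k, -, hk⟩ := Finset.exists_mem_notMem_of_card_lt_card (s := {i, j})
    (t := (Finset.univ : Finset (Fin (d + 3))))
    (by rw [Finset.card_univ, Fintype.card_fin]; exact Finset.card_le_two.trans_lt (by omega))
  simp only [Finset.mem_insert, Finset.mem_singleton, not_or] at hk
  exact ⟨k, Ne.symm hk.1, Ne.symm hk.2⟩

/-- The linear functional defined by a row of a matrix. -/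
noncomputable def rowFunctional {n m : ℕ} (D : Matrix (Fin n) (Fin m) ℝ) (i : Fin n) :
    (Fin m → ℝ) →L[ℝ] ℝ :=
  (ContinuousLinearMap.proj i).comp (LinearMap.toContinuousLinearMap D.mulVecLin)

theorem rowFunctional_apply {n m : ℕ} (D : Matrix (Fin n) (Fin m) ℝ) (i : Fin n)
    (y : Fin m → ℝ) : rowFunctional D i y = D i ⬝ᵥ y := rfl

/-- A member of a hull on which a nonnegative functional vanishes is in the span of the generators
on which the functional vanishes. -/
theorem mem_span_of_mem_hull {m : ℕ} {G : Set (Fin m → ℝ)} {x : Fin m → ℝ}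
    (hG : ∀ g ∈ G, 0 ≤ g ⬝ᵥ x) {p : Fin m → ℝ} (hp : p ∈ PointedCone.hull ℝ G) :
    0 ≤ p ⬝ᵥ x ∧ (p ⬝ᵥ x = 0 → p ∈ Submodule.span ℝ {g ∈ G | g ⬝ᵥ x = 0}) := by
  induction hp using Submodule.span_induction with
  | mem g hg => exact ⟨hG g hg, fun h => Submodule.subset_span ⟨hg, h⟩⟩
  | zero => simp
  | add y z _ _ hy hz =>
    rw [add_dotProduct]
    refine ⟨add_nonneg hy.1 hz.1, fun h => ?_⟩
    exact add_mem (hy.2 (by linarith [hy.1, hz.1])) (hz.2 (by linarith [hy.1, hz.1]))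
  | smul c y _ hy =>
    have hc : c • y = (c : ℝ) • y := rfl
    rw [hc, smul_dotProduct, smul_eq_mul]
    refine ⟨mul_nonneg c.2 hy.1, fun h => ?_⟩
    rcases mul_eq_zero.1 h with h | h
    · rw [h, zero_smul]; exact zero_mem _
    · exact Submodule.smul_mem _ _ (hy.2 h)

/-- If `D i` vanished at `x`, it would lie in the span of the generators vanishing at `x`. By the
independence of any three rows there is at most one of these, so `D i` would be a multiple of a
single other row, against the same independence. -/
theorem row_pos_of_notMem_generators {d : ℕ} {C : Matrix (Fin d) (Fin (d + 3)) ℝ}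
    (hC : IsUniform C) {D : Matrix (Fin (d + 3)) (Fin 3) ℝ} (hD : IsGaleDual C D)
    {I : Set (Fin (d + 3))} (hI : PointedCone.hull ℝ (D '' I) = PointedCone.hull ℝ (range D))
    {x : Fin 3 → ℝ} (hx : ∀ i ∈ I, 0 ≤ D i ⬝ᵥ x) (hx0 : x ≠ 0) {i : Fin (d + 3)} (hi : i ∉ I) :
    0 < D i ⬝ᵥ x := by
  have hmem : D i ∈ PointedCone.hull ℝ (D '' I) := by
    rw [hI]; exact Submodule.subset_span ⟨i, rfl⟩
  obtain ⟨h1, h2⟩ := mem_span_of_mem_hull (x := x) (by rintro _ ⟨k, hk, rfl⟩; exact hx k hk) hmem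
  refine lt_of_le_of_ne h1 fun h0 => ?_
  replace h2 := h2 h0.symm
  obtain ⟨k, hik, hk⟩ : ∃ k, i ≠ k ∧ ∀ k' ∈ I, D k' ⬝ᵥ x = 0 → k' = k := by
    by_cases h : ∃ k ∈ I, D k ⬝ᵥ x = 0
    · obtain ⟨k, hkI, hk⟩ := h
      refine ⟨k, by rintro rfl; exact hi hkI, fun k' hk'I hk' => ?_⟩
      by_contra hne
      exact hx0 (eq_zero_of_three_rows hC hD (i := i) (j := k) (k := k')
        (by rintro rfl; exact hi hkI) (by rintro rfl; exact hi hk'I) (Ne.symm hne) h0.symm hk hk')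
    · obtain ⟨k, hk, -⟩ := exists_ne_ne i i
      exact ⟨k, hk, fun k' h1 h2 => (h ⟨k', h1, h2⟩).elim⟩
  obtain ⟨m, him, hkm⟩ := exists_ne_ne i k
  -- Two functionals on a 3-space have a common nonzero zero; `D i`, a multiple of `D k`, vanishes
  -- there too.
  have hker : LinearMap.ker (LinearMap.prod (rowFunctional D k : (Fin 3 → ℝ) →ₗ[ℝ] ℝ)
      (rowFunctional D m : (Fin 3 → ℝ) →ₗ[ℝ] ℝ)) ≠ ⊥ :=
    LinearMap.ker_ne_bot_of_finrank_lt (by simp)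
  obtain ⟨y, hy, hy0⟩ := Submodule.exists_mem_ne_zero_of_ne_bot hker
  have hyk : D k ⬝ᵥ y = 0 := congrArg Prod.fst (LinearMap.mem_ker.1 hy)
  have hym : D m ⬝ᵥ y = 0 := congrArg Prod.snd (LinearMap.mem_ker.1 hy)
  refine hy0 (eq_zero_of_three_rows hC hD hik him hkm ?_ hyk hym)
  generalize D i = p at h2
  induction h2 using Submodule.span_induction with
  | mem g hg =>
    obtain ⟨⟨k', hk', rfl⟩, hg⟩ := hg
    rw [hk k' hk' hg, hyk]
  | zero => simp
  | add y z _ _ hy hz => rw [add_dotProduct, hy, hz, add_zero]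
  | smul c y _ hy => rw [smul_dotProduct, hy, smul_zero]

/-- A facet spans a plane, while two distinct rows vanish together only on a line. So each other row
is positive somewhere on the facet, and summing such points makes all of them positive at once. -/
theorem exists_facet_point {d : ℕ} {C : Matrix (Fin d) (Fin (d + 3)) ℝ} (hC : IsUniform C)
    {D : Matrix (Fin (d + 3)) (Fin 3) ℝ} (hD : IsGaleDual C D) (hne : (dualOpenCone D).Nonempty)
    {q : Fin (d + 3)} (hq : IsFacetNormal (closure (dualOpenCone D)) (D q)) :
    ∃ m, D q ⬝ᵥ m = 0 ∧ ∀ i ≠ q, 0 < D i ⬝ᵥ m := by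
  have hopen : IsOpen (dualOpenCone D) := by
    have h : dualOpenCone D = ⋂ i, {y | 0 < rowFunctional D i y} := by
      ext y; simp [dualOpenCone, rowFunctional_apply]
    rw [h]
    exact isOpen_iInter_of_finite fun i => isOpen_lt continuous_const (rowFunctional D i).continuous
  have hcl : ∀ y ∈ closure (dualOpenCone D), ∀ i, 0 ≤ D i ⬝ᵥ y := fun y hy i =>
    closure_minimal (t := {y | 0 ≤ rowFunctional D i y}) (fun y hy => (hy i).le)
      (isClosed_le continuous_const (rowFunctional D i).continuous) hy
  have hspan : vectorSpan ℝ (closure (dualOpenCone D)) = ⊤ := by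
    refine top_unique (le_trans ?_ (vectorSpan_mono ℝ subset_closure))
    rw [← direction_affineSpan, hopen.affineSpan_eq_top hne, AffineSubspace.direction_top]
  obtain ⟨-, hFne, hdim⟩ := hq
  set F : Set (Fin 3 → ℝ) := {y | y ∈ closure (dualOpenCone D) ∧ D q ⬝ᵥ y = 0} with hF
  rw [hspan, finrank_top, Module.finrank_fin_fun] at hdim
  have hex : ∀ i, ∃ f ∈ F, i ≠ q → 0 < D i ⬝ᵥ f := by
    intro i
    by_contra! hcon
    obtain ⟨f, hf⟩ := hFne
    have hiq := (hcon f hf).1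
    obtain ⟨k, hik, hqk⟩ := exists_ne_ne i q
    set W : Submodule ℝ (Fin 3 → ℝ) :=
      LinearMap.ker (rowFunctional D i : (Fin 3 → ℝ) →ₗ[ℝ] ℝ) ⊓
        LinearMap.ker (rowFunctional D q : (Fin 3 → ℝ) →ₗ[ℝ] ℝ) with hW
    have hFW : F ⊆ W := fun y hy =>
      ⟨le_antisymm (hcon y hy).2 (hcl y hy.1 i), hy.2⟩
    have hle : vectorSpan ℝ F ≤ W := by
      rw [vectorSpan_def, Submodule.span_le]
      rintro _ ⟨y, hy, z, hz, rfl⟩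
      exact W.sub_mem (hFW hy) (hFW hz)
    have hW1 : Module.finrank ℝ W ≤ 1 := by
      have hinj : Function.Injective
          ((rowFunctional D k : (Fin 3 → ℝ) →ₗ[ℝ] ℝ).domRestrict W) := by
        rw [← LinearMap.ker_eq_bot, LinearMap.ker_eq_bot']
        rintro ⟨y, hyi, hyq⟩ hy
        exact Subtype.ext (eq_zero_of_three_rows hC hD hiq hik hqk hyi hyq hy)
      simpa using LinearMap.finrank_le_finrank_of_injective hinj
    have := Submodule.finrank_mono hle
    omega
  choose f hf hfpos using hex
  refine ⟨∑ i, f i, ?_, fun i hi => ?_⟩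
  · rw [dotProduct_sum]
    exact Finset.sum_eq_zero fun i _ => (hf i).2
  · rw [dotProduct_sum]
    exact Finset.sum_pos' (fun k _ => hcl _ (hf k).1 i) ⟨i, Finset.mem_univ i, hfpos i hi⟩

/-! ### Gale duality for the polynomial system, and the conclusion. -/

/-- A vector orthogonal to the columns of a Gale dual is in the row space. -/
theorem exists_vecMul_eq_of_isGaleDual {r s k : ℕ} {M : Matrix (Fin r) (Fin s) ℝ}
    {N : Matrix (Fin s) (Fin k) ℝ} (h : IsGaleDual M N) {w : Fin s → ℝ}
    (hw : ∀ j, ∑ i, N i j * w i = 0) : ∃ c : Fin r → ℝ, c ᵥ* M = w := by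
  have hwN : w ᵥ* N = 0 := by
    ext j
    simpa [Matrix.vecMul, dotProduct, mul_comm] using hw j
  have hmem : dotProductBilin ℝ ℝ w ∈ LinearMap.range M.mulVecLin.dualMap := by
    rw [LinearMap.range_dualMap_eq_dualAnnihilator_ker, Submodule.mem_dualAnnihilator]
    intro z hz
    obtain ⟨y, rfl⟩ := h.mulVec_eq_zero_iff.1 (LinearMap.mem_ker.1 hz)
    change w ⬝ᵥ N *ᵥ y = 0
    rw [Matrix.dotProduct_mulVec, hwN, zero_dotProduct]
  obtain ⟨ψ, hψ⟩ := hmem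
  refine ⟨fun t => ψ (Pi.single t 1), ?_⟩
  ext i
  have h1 := LinearMap.congr_fun hψ (Pi.single i 1)
  have h2 : w ⬝ᵥ Pi.single i 1 = w i := by simp
  have h3 : M *ᵥ Pi.single i 1 = ∑ t, M t i • (Pi.single t 1 : Fin r → ℝ) := by
    ext t
    simp [Finset.sum_apply, Pi.single_apply]
  change ψ (M *ᵥ Pi.single i 1) = w ⬝ᵥ Pi.single i 1 at h1
  rw [h2, h3, map_sum] at h1
  simpa [Matrix.vecMul, dotProduct, mul_comm] using h1

/-- Gale duality: positive vectors in the kernel satisfying the dual system give solutions. -/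
theorem positiveSolutions_nonempty_of_galeDual {d n k : ℕ} {a : Fin n → Fin d → ℝ}
    {B : Matrix (Fin n) (Fin k) ℝ} (hB : IsGaleDual (configMatrix a) B)
    {C : Matrix (Fin d) (Fin n) ℝ} {z : Fin n → ℝ} (hz : ∀ i, 0 < z i) (hCz : C *ᵥ z = 0)
    (hBz : ∀ j, ∑ i, B i j * Real.log (z i) = 0) : (positiveSolutions a C).Nonempty := by
  obtain ⟨c, hc⟩ := exists_vecMul_eq_of_isGaleDual hB hBz
  -- The row of ones contributes `c 0`, a common scaling of `z` that the homogeneous system ignores;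
  -- the other coefficients are the logarithms of the solution.
  have hc' : ∀ i, c 0 + ∑ l, c (Fin.succ l) * a i l = Real.log (z i) := fun i => by
    rw [← congrFun hc i]
    simp [Matrix.vecMul, dotProduct, Fin.sum_univ_succ, configMatrix]
  have hmon : ∀ j, ∏ l, Real.exp (c (Fin.succ l)) ^ a j l = Real.exp (-c 0) * z j := fun j => by
    simp_rw [← Real.exp_mul]
    rw [← Real.exp_sum, ← Real.exp_log (hz j), ← Real.exp_add, ← hc' j]
    congr 1
    ring
  refine ⟨fun l => Real.exp (c (Fin.succ l)), fun l => Real.exp_pos _, fun i => ?_⟩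
  simp_rw [hmon, mul_left_comm (C i _)]
  rw [← Finset.mul_sum]
  have : ∑ j, C i j * z j = 0 := congrFun hCz i
  rw [this, mul_zero]

theorem lemma5p9 (d : ℕ)
    (a : Fin (d + 3) → Fin d → ℝ) (hA : IsUniform (configMatrix a))
    (B : Matrix (Fin (d + 3)) (Fin 2) ℝ) (hB : IsGaleDual (configMatrix a) B)
    (q : Fin 4 → Fin (d + 3)) (hq : ∀ j, B (q j) ∈ openQuadrant j)
    (C : Matrix (Fin d) (Fin (d + 3)) ℝ) (hC : IsUniform C)
    (h0 : (0 : Fin d → ℝ) ∈ openCone Cᵀ)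
    (D : Matrix (Fin (d + 3)) (Fin 3) ℝ) (hD : IsGaleDual C D)
    (hfacet : ∀ j, IsFacetNormal (closure (dualOpenCone D)) (D (q j)))
    (I : Set (Fin (d + 3))) (hI : IsMinimalGenerating D I)
    (hsign : ∀ j, signVec (restrictTo I (Bᵀ j)) ∈
      signVec '' (restrictTo I '' {z : Fin (d + 3) → ℝ | C *ᵥ z = 0})) :
    0 < numPositiveSolutions a C := by
  obtain ⟨u₀, hu₀⟩ : (dualOpenCone D).Nonempty := by
    obtain ⟨c, hc, hc0⟩ := h0
    have hCc : C *ᵥ c = 0 := by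
      rw [hc0]
      ext i
      simp [Matrix.mulVec, dotProduct, Finset.sum_apply, mul_comm]
    obtain ⟨y, rfl⟩ := hD.mulVec_eq_zero_iff.1 hCc
    exact ⟨y, hc⟩
  have hIpos : ∀ x, (∀ i ∈ I, 0 ≤ rowFunctional D i x) → x ≠ 0 → ∀ i ∉ I,
      0 < rowFunctional D i x := fun x hx hx0 i hi =>
    row_pos_of_notMem_generators hC hD hI.1 hx hx0 hi
  choose m hm hm_pos using fun k => exists_facet_point hC hD ⟨u₀, hu₀⟩ (hfacet k)
  -- A row outside `I` is positive at every nonzero point of the closed cone, but `D (q k)` vanishes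
  -- at `m k`.
  have hqI : ∀ k, q k ∈ I := fun k => by
    by_contra hk
    have hle : ∀ i, 0 ≤ D i ⬝ᵥ m k := fun i => by
      by_cases h : i = q k
      · rw [h, hm]
      · exact (hm_pos k i h).le
    have hmk : m k ≠ 0 := fun h => by
      obtain ⟨i, hi, -⟩ := exists_ne_ne (q k) (q k)
      simpa [h] using hm_pos k i hi.symm
    exact (hIpos (m k) (fun i _ => hle i) hmk _ hk).ne' (hm k)
  have hv : ∀ j, ∃ v, ∀ i ∈ I,
      SignType.sign (rowFunctional D i v) = SignType.sign (Bᵀ j i) := fun j => by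
    obtain ⟨_, ⟨z, hz, rfl⟩, hs⟩ := hsign j
    obtain ⟨v, rfl⟩ := hD.mulVec_eq_zero_iff.1 hz
    exact ⟨v, fun i hi => congrFun hs ⟨i, hi⟩⟩
  choose v hv using hv
  obtain ⟨u, hu, hu0⟩ := exists_zero_logarithmic_map (l := rowFunctional D) hIpos hu₀ hv hqI hq
    hm hm_pos
  exact encard_pos.2 (positiveSolutions_nonempty_of_galeDual hB (z := D *ᵥ u) hu
    (hD.mulVec_eq_zero_iff.2 ⟨u, rfl⟩) hu0)
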